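/- Let $V$ be a Euclidean Jordan algebra, i.e. a finite-dimensional real inner product space with a commutative bilinear product having a unit $e$ and satisfying $(xy)x^2=x(yx^2)$ and $\langle xy,z\rangle=\langle y,xz\rangle$ for all $x,y,z\in V$. Let $Q=\{x^2: x\in V\}$ be its cone of squares (a closed convex cone), and write $x\le_Q y$ if $y-x\in Q$. For a nonempty closed convex set $D\subseteq V$ and $x\in V$ let $P_D x$ denote the unique point of $D$ nearest to $x$. A set $M\subseteq V$ is called lattice-like in $(V,Q)$ if $P_{x-Q}\,y\in M$ and $P_{x+Q}\,y\in M$ for all $x,y\in M$. A face of $Q$ is a convex cone $F\subseteq Q$ with $0\in F$ such that $0\le_Q x\le_Q y$ and $y\in F$ imply $x\in F$. Then for every face $F$ of $Q$ the linear span of $F$ is a lattice-like subspace of $(V,Q)$. -/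

import Mathlib

open scoped Pointwise

/-- A Jordan product with unit on a real inner product space `V`, for which the inner product is
associative. Together with `FiniteDimensional ℝ V` this is a Euclidean Jordan algebra.
Commutativity is `mul_comm`, the unit laws are those of `MulOneClass`, and the Jordan identity
`(x y) (x x) = x (y (x x))` is `IsCommJordan`. -/
class EuclideanJordanAlgebra (V : Type*) [NormedAddCommGroup V] [InnerProductSpace ℝ V]
    extends CommMagma V, MulOneClass V, IsCommJordan V where
  protected add_mul : ∀ x y z : V, (x + y) * z = x * z + y * z
  protected smul_mul : ∀ (t : ℝ) (x y : V), (t • x) * y = t • (x * y)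
  protected inner_mul_left : ∀ x y z : V, inner ℝ (x * y) z = inner ℝ y (x * z)

/-- The cone of squares `Q = {x² : x ∈ V}`. -/
def coneOfSquares (V : Type*) [Mul V] : Set V :=
  Set.range fun x : V => x * x

/-- The relation `x ≤_K y`, that is, `y - x ∈ K`. -/
def ConeLE {V : Type*} [AddCommGroup V] (K : Set V) (x y : V) : Prop :=
  y - x ∈ K

/-- The point `p` is the metric projection `P_D x`: it lies in `D` and is the unique point of `D`
nearest to `x`. -/
def IsMetricProjection {V : Type*} [NormedAddCommGroup V] (D : Set V) (x p : V) : Prop :=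
  p ∈ D ∧ (∀ y ∈ D, ‖x - p‖ ≤ ‖x - y‖) ∧ ∀ q ∈ D, (∀ y ∈ D, ‖x - q‖ ≤ ‖x - y‖) → q = p

/-- The metric projection of `x` onto `D`, if it exists, is unique. -/
theorem IsMetricProjection.unique {V : Type*} [NormedAddCommGroup V] {D : Set V} {x p q : V}
    (hp : IsMetricProjection D x p) (hq : IsMetricProjection D x q) : q = p :=
  hp.2.2 q hq.1 hq.2.1

/-- The set `M` is lattice-like in `(V, K)`: it is invariant under the operations
`x ⊓_K y = P_{x - K} y` and `x ⊔_K y = P_{x + K} y`. The existence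
of the projections (automatic if `K` is a closed convex cone) is part of the condition. -/
structure IsLatticeLike {V : Type*} [NormedAddCommGroup V] (K M : Set V) : Prop where
  meet_mem : ∀ x ∈ M, ∀ y ∈ M, ∃ p, IsMetricProjection ({x} - K) y p ∧ p ∈ M
  join_mem : ∀ x ∈ M, ∀ y ∈ M, ∃ p, IsMetricProjection ({x} + K) y p ∧ p ∈ M

/-- The convex cone `F` (containing `0`) is a face of `K`: it is contained in `K`, and
`0 ≤_K x ≤_K y` with `y ∈ F` implies `x ∈ F`. -/
structure IsConeFace {V : Type*} [AddCommGroup V] [Module ℝ V]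
    (K : Set V) (F : PointedCone ℝ V) : Prop where
  subset : (F : Set V) ⊆ K
  mem_of_le : ∀ x y : V, ConeLE K 0 x → ConeLE K x y → y ∈ F → x ∈ F

/-! The spectral calculus splits `z` as `z⁺ - z⁻` with `z⁺`, `z⁻` orthogonal squares. Squares have
nonnegative inner products, so `P_Q z = z⁺`; by isometry the two lattice operations are `x - (x -
y)⁺` and `x + (y - x)⁺`. It remains to show `z⁺ ∈ F` for `z ∈ span F` (`posPart_mem_face`).

Write `z = a - b` with `a, b ∈ F`, and let `c` be the support idempotent of `a + b`. Since `c ≤ t (a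
+ b)`, `c ∈ F`. The idempotent `e - c` annihilates `a` and `b`, hence `z`, hence `z⁺`. This sharpens
`z⁺ ≤ r e` to `z⁺ ≤ r c` (`coneLE_smul_idempotent`), so `z⁺ ∈ F`. -/

namespace EuclideanJordanAlgebra

open Polynomial

variable {V : Type*} [NormedAddCommGroup V] [InnerProductSpace ℝ V] [EuclideanJordanAlgebra V]

/-! ### Multiplication operators and power associativity. -/

/-- The multiplication operators `L x : y ↦ x * y`, as a linear map in `x`. -/
noncomputable def mulOp : V →ₗ[ℝ] Module.End ℝ V :=
  LinearMap.mk₂ ℝ (fun x y => x * y) EuclideanJordanAlgebra.add_mul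
    EuclideanJordanAlgebra.smul_mul
    (fun x y z => by
      rw [mul_comm, EuclideanJordanAlgebra.add_mul, mul_comm y, mul_comm z])
    (fun t x y => by rw [mul_comm, EuclideanJordanAlgebra.smul_mul, mul_comm y])

@[simp] theorem mulOp_apply (x y : V) : mulOp x y = x * y := rfl

theorem mulOp_isSymmetric (x : V) : (mulOp x).IsSymmetric := fun y z =>
  EuclideanJordanAlgebra.inner_mul_left x y z

/-- The ring structure underlying a Euclidean Jordan algebra. -/
abbrev toNonUnitalNonAssocCommRing : NonUnitalNonAssocCommRing V :=
  { (inferInstance : AddCommGroup V), (inferInstance : CommMagma V) with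
    left_distrib := fun x y z => (mulOp x).map_add y z
    right_distrib := EuclideanJordanAlgebra.add_mul
    zero_mul := fun x => by
      change mulOp 0 x = 0
      simp
    mul_zero := fun x => (mulOp x).map_zero }

/-- The linearized Jordan identity. -/
theorem linearized_jordan (a b c d : V) :
    a * ((b * c) * d) + b * ((c * a) * d) + c * ((a * b) * d) =
      (b * c) * (a * d) + (c * a) * (b * d) + (a * b) * (c * d) := by
  let := toNonUnitalNonAssocCommRing (V := V)
  have h := DFunLike.congr_fun (two_nsmul_lie_lmul_lmul_add_add_eq_zero a b c) d
  simp only [Ring.lie_def] at h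
  have h' : (2 : ℕ) • ((a * ((b * c) * d) - (b * c) * (a * d)) +
      (b * ((c * a) * d) - (c * a) * (b * d)) + (c * ((a * b) * d) - (a * b) * (c * d))) = 0 := h
  have h2 : (2 : ℝ) • ((a * ((b * c) * d) - (b * c) * (a * d)) +
      (b * ((c * a) * d) - (c * a) * (b * d)) + (c * ((a * b) * d) - (a * b) * (c * d))) = 0 := by
    rw [two_smul]
    rw [two_nsmul] at h'
    exact h'
  have h3 := (smul_eq_zero.1 h2).resolve_left two_ne_zero
  rw [← sub_eq_zero, ← h3]
  abel

/-- This is `linearized_jordan` with `a` in the last slot and the operand `d` in the first. It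
drives the induction on powers and yields the cubic equation of an idempotent. -/
theorem mulOp_mul_mul (a b c : V) :
    mulOp (a * (b * c)) = mulOp (b * c) * mulOp a + mulOp (c * a) * mulOp b
      + mulOp (a * b) * mulOp c - mulOp b * mulOp a * mulOp c - mulOp c * mulOp a * mulOp b := by
  ext d
  have h₂ := linearized_jordan d b c a
  simp only [mulOp_apply, LinearMap.add_apply, LinearMap.sub_apply, Module.End.mul_apply]
  rw [mul_comm d ((b * c) * a), mul_comm (b * c) a, mul_comm (c * d) a, mul_comm (d * b) a,
    mul_comm d a, mul_comm d b, mul_comm (c * d) (b * a), mul_comm (b * d) (c * a),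
    mul_comm b a] at h₂
  have h : ((b * c) * (a * d) + (c * a) * (b * d) + (a * b) * (c * d)) =
      (a * (b * c)) * d + b * (a * (c * d)) + c * (a * (b * d)) := by
    rw [h₂]
    abel
  rw [h]
  abel

/-- An operator commuting with `L z` and `L (z * z)` commutes with `L` of every power of `z`. -/
theorem commute_mulOp_pow {z : V} {S : Module.End ℝ V} (h₁ : Commute S (mulOp z))
    (h₂ : Commute S (mulOp (z * z))) (n : ℕ) : Commute S (mulOp ((mulOp z ^ n) 1)) := by
  induction n using Nat.twoStepInduction with
  | zero =>
    have : mulOp (1 : V) = 1 := by ext; simp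
    simp [this]
  | one => simpa using h₁
  | more n ih₁ ih₂ =>
    have h : mulOp z * mulOp z = mulOp z ^ 2 := (sq _).symm
    -- As `z^(n+2) = z (z z^n)`, its operator is a polynomial in those of `z`, `z²`, `z^n` and
    -- `z^(n+1)`.
    rw [pow_succ', pow_succ', Module.End.mul_apply, Module.End.mul_apply, mulOp_apply, mulOp_apply,
      mulOp_mul_mul]
    rw [pow_succ', Module.End.mul_apply, mulOp_apply] at ih₂
    rw [mul_comm ((mulOp z ^ n) 1) z]
    exact ((((ih₂.mul_right h₁).add_right (ih₂.mul_right h₁)).add_right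
      (h₂.mul_right ih₁)).sub_right ((h₁.mul_right h₁).mul_right ih₁)).sub_right
      ((ih₁.mul_right h₁).mul_right h₁)

theorem commute_mulOp_mulOp_sq (z : V) : Commute (mulOp z) (mulOp (z * z)) := by
  ext d
  have h := IsCommJordan.lmul_comm_rmul_rmul z d
  simp only [Module.End.mul_apply, mulOp_apply]
  rw [mul_comm (z * z) d, ← h, mul_comm]

/-- Evaluation of a polynomial at an element of a Euclidean Jordan algebra. -/
noncomputable def polyEval (z : V) : ℝ[X] →ₗ[ℝ] V :=
  (LinearMap.applyₗ (1 : V)).comp (aeval (mulOp z)).toLinearMap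

theorem polyEval_apply (z : V) (p : ℝ[X]) : polyEval z p = aeval (mulOp z) p 1 := rfl

theorem commute_mulOp_polyEval (z : V) (p : ℝ[X]) :
    Commute (mulOp z) (mulOp (polyEval z p)) := by
  induction p using Polynomial.induction_on' with
  | add p q hp hq =>
    rw [map_add, map_add]
    exact hp.add_right hq
  | monomial n a =>
    have h : polyEval z (monomial n a) = a • (mulOp z ^ n) 1 := by
      simp [polyEval_apply, aeval_monomial]
    rw [h, map_smul]
    exact (commute_mulOp_pow (Commute.refl _) (commute_mulOp_mulOp_sq z) n).smul_right a

theorem commute_aeval_right {A : Type*} [Ring A] [Algebra ℝ A] {S T : A} (h : Commute S T)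
    (q : ℝ[X]) : Commute S (aeval T q) := by
  induction q using Polynomial.induction_on' with
  | add p q hp hq =>
    rw [map_add]
    exact hp.add_right hq
  | monomial n a =>
    rw [aeval_monomial]
    exact (Algebra.commute_algebraMap_right a S).mul_right (h.pow_right n)

/-- Power associativity. -/
theorem polyEval_mul (z : V) (p q : ℝ[X]) :
    polyEval z (p * q) = polyEval z p * polyEval z q := by
  -- Applied to the unit, commutation of `L (p(z))` with `q(L z)` reads `p(z) q(z) = q(L z) p(z)`.
  have h := DFunLike.congr_fun
    (commute_aeval_right (commute_mulOp_polyEval z p).symm q).eq (1 : V)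
  simp only [Module.End.mul_apply, mulOp_apply, mul_one] at h
  rw [polyEval_apply z q, h, mul_comm p q, polyEval_apply, map_mul, Module.End.mul_apply,
    ← polyEval_apply]

theorem polyEval_one (z : V) : polyEval z 1 = 1 := by simp [polyEval_apply]

theorem polyEval_X (z : V) : polyEval z X = z := by simp [polyEval_apply]

theorem inner_mul_one (x y : V) : inner ℝ (x * y) 1 = inner ℝ x y := by
  rw [mul_comm, EuclideanJordanAlgebra.inner_mul_left, mul_one]

theorem inner_mul_right_comm (x y z : V) : inner ℝ (x * y) z = inner ℝ x (y * z) := by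
  rw [mul_comm, EuclideanJordanAlgebra.inner_mul_left]

/-- Multiplication by an idempotent is positive semidefinite. -/
theorem inner_idempotent_mul_self_nonneg {c : V} (hc : c * c = c) (y : V) :
    0 ≤ inner ℝ (c * y) y := by
  -- For `T = L c` this says `T = 3T² - 2T³`.
  have h := DFunLike.congr_fun (mulOp_mul_mul c c c) y
  simp only [hc, LinearMap.add_apply, LinearMap.sub_apply, Module.End.mul_apply, mulOp_apply] at h
  set y₁ := c * y with hy₁
  set y₂ := c * y₁ with hy₂
  set y₃ := c * y₂ with hy₃
  have e : ∀ u v : V, inner ℝ (c * u) v = inner ℝ u (c * v) :=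
    EuclideanJordanAlgebra.inner_mul_left c
  have e₀₂ : inner ℝ y₁ y₁ = inner ℝ y₂ y := by rw [hy₂, e, real_inner_comm, e, real_inner_comm]
  have e₃₀ : inner ℝ y₃ y = inner ℝ y₂ y₁ := by rw [hy₃, e, ← hy₁]
  have e₃₁ : inner ℝ y₃ y₁ = inner ℝ y₂ y₂ := by rw [hy₃, e, ← hy₂]
  have k₀ := congrArg (fun v => inner ℝ v y) h
  have k₁ := congrArg (fun v => inner ℝ v y₁) h
  simp only [inner_add_left, inner_sub_left] at k₀ k₁
  -- The cubic gives `T = (2T² - T)² + 8 (T - T²)²`.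
  have p₁ : 0 ≤ inner ℝ ((2 : ℝ) • y₂ - y₁) ((2 : ℝ) • y₂ - y₁) := real_inner_self_nonneg
  have p₂ : 0 ≤ inner ℝ (y₁ - y₂) (y₁ - y₂) := real_inner_self_nonneg
  simp only [inner_sub_left, inner_sub_right, inner_smul_left, inner_smul_right,
    real_inner_comm y₂ y₁, RCLike.conj_to_real] at p₁ p₂
  linarith

/-! ### Functional calculus of one element. -/

section FiniteDimensional

variable [FiniteDimensional ℝ V]

/-- `L z` is symmetric, so it has an eigenbasis, on which `p(L z)` acts through the values of `p` at
eigenvalues. -/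
theorem polyEval_congr {z : V} {p q : ℝ[X]}
    (h : ∀ μ : ℝ, Module.End.HasEigenvalue (mulOp z) μ → p.eval μ = q.eval μ) :
    polyEval z p = polyEval z q := by
  have hT := mulOp_isSymmetric z
  rw [polyEval_apply, polyEval_apply]
  congr 1
  refine (hT.eigenvectorBasis rfl).toBasis.ext fun i => ?_
  rw [OrthonormalBasis.coe_toBasis,
    Module.End.aeval_apply_of_hasEigenvector (hT.hasEigenvector_eigenvectorBasis rfl i),
    Module.End.aeval_apply_of_hasEigenvector (hT.hasEigenvector_eigenvectorBasis rfl i)]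
  congr 1
  exact h _ (hT.hasEigenvalue_eigenvalues rfl i)

/-- The eigenvalues of multiplication by `z`. -/
noncomputable def mulSpectrum (z : V) : Finset ℝ :=
  (Module.End.finite_hasEigenvalue (mulOp z)).toFinset

theorem mem_mulSpectrum {z : V} {μ : ℝ} :
    μ ∈ mulSpectrum z ↔ Module.End.HasEigenvalue (mulOp z) μ := by
  simp [mulSpectrum]

/-- The functional calculus of an element of a Euclidean Jordan algebra. -/
noncomputable def funCalc (z : V) (f : ℝ → ℝ) : V := polyEval z (Lagrange.interpolate (mulSpectrum z) id f)

theorem polyEval_eq_funCalc {z : V} {p : ℝ[X]} {f : ℝ → ℝ}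
    (h : ∀ μ ∈ mulSpectrum z, p.eval μ = f μ) : polyEval z p = funCalc z f := by
  refine polyEval_congr fun μ hμ => ?_
  have hμ := mem_mulSpectrum.2 hμ
  rw [h μ hμ]
  exact (Lagrange.eval_interpolate_at_node f (Function.injective_id.injOn) hμ).symm

theorem eval_interpolate_mulSpectrum {z : V} (f : ℝ → ℝ) {μ : ℝ} (hμ : μ ∈ mulSpectrum z) :
    (Lagrange.interpolate (mulSpectrum z) id f).eval μ = f μ :=
  Lagrange.eval_interpolate_at_node f (Function.injective_id.injOn) hμ

theorem funCalc_congr {z : V} {f g : ℝ → ℝ} (h : ∀ μ ∈ mulSpectrum z, f μ = g μ) :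
    funCalc z f = funCalc z g :=
  polyEval_eq_funCalc fun μ hμ => (eval_interpolate_mulSpectrum f hμ).trans (h μ hμ)

theorem funCalc_mul (z : V) (f g : ℝ → ℝ) :
    funCalc z (fun t => f t * g t) = funCalc z f * funCalc z g := by
  rw [funCalc.eq_def z f, funCalc.eq_def z g, ← polyEval_mul]
  refine (polyEval_eq_funCalc fun μ hμ => ?_).symm
  rw [eval_mul, eval_interpolate_mulSpectrum f hμ, eval_interpolate_mulSpectrum g hμ]

theorem funCalc_sub (z : V) (f g : ℝ → ℝ) :
    funCalc z (fun t => f t - g t) = funCalc z f - funCalc z g := by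
  rw [funCalc, funCalc, funCalc, ← map_sub, ← map_sub]
  rfl

theorem funCalc_smul (z : V) (a : ℝ) (f : ℝ → ℝ) :
    funCalc z (fun t => a * f t) = a • funCalc z f := by
  rw [funCalc, funCalc, ← map_smul, ← map_smul]
  rfl

theorem funCalc_sum {ι : Type*} (z : V) (s : Finset ι) (f : ι → ℝ → ℝ) :
    funCalc z (fun t => ∑ i ∈ s, f i t) = ∑ i ∈ s, funCalc z (f i) := by
  simp only [funCalc]
  rw [← map_sum, ← map_sum]
  congr 2
  ext t
  simp

theorem funCalc_id (z : V) : funCalc z (fun t => t) = z := by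
  rw [← polyEval_eq_funCalc (p := X) (by simp), polyEval_X]

theorem funCalc_one (z : V) : funCalc z (fun _ => 1) = 1 := by
  rw [← polyEval_eq_funCalc (p := 1) (by simp), polyEval_one]

theorem funCalc_zero (z : V) : funCalc z (fun _ => 0) = 0 := by
  rw [← polyEval_eq_funCalc (p := 0) (by simp), map_zero]

theorem funCalc_mem_coneOfSquares {z : V} {f : ℝ → ℝ} (h : ∀ μ ∈ mulSpectrum z, 0 ≤ f μ) :
    funCalc z f ∈ coneOfSquares V :=
  ⟨funCalc z fun t => √(f t), by
    change funCalc z _ * funCalc z _ = _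
    rw [← funCalc_mul]
    exact funCalc_congr fun μ hμ => Real.mul_self_sqrt (h μ hμ)⟩

/-! ### Positivity of the cone of squares. -/

/-- Multiplication by a square is positive semidefinite. -/
theorem inner_square_mul_self_nonneg (x y : V) : 0 ≤ inner ℝ ((x * x) * y) y := by
  classical
  -- Spectral decomposition: `x²` is a nonnegative combination of idempotents.
  have hx : x * x = ∑ μ ∈ mulSpectrum x, (μ * μ) • funCalc x (fun t => if t = μ then 1 else 0) := by
    have : x * x = funCalc x (fun t => t * t) := by rw [funCalc_mul, funCalc_id]
    rw [this]
    simp_rw [← funCalc_smul]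
    rw [← funCalc_sum]
    exact funCalc_congr fun μ hμ => by simp [hμ]
  have hmul : (x * x) * y = ∑ μ ∈ mulSpectrum x,
      (μ * μ) • (funCalc x (fun t => if t = μ then 1 else 0) * y) := by
    rw [hx, ← mulOp_apply, map_sum, LinearMap.sum_apply]
    simp
  rw [hmul, sum_inner]
  refine Finset.sum_nonneg fun μ _ => ?_
  rw [real_inner_smul_left]
  refine mul_nonneg (mul_self_nonneg μ) (inner_idempotent_mul_self_nonneg ?_ y)
  rw [← funCalc_mul]
  exact funCalc_congr fun μ _ => by split_ifs <;> simp

/-- Any two elements of the cone of squares have nonnegative inner product. -/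
theorem inner_nonneg_of_mem_coneOfSquares {x y : V} (hx : x ∈ coneOfSquares V)
    (hy : y ∈ coneOfSquares V) : 0 ≤ inner ℝ x y := by
  obtain ⟨u, rfl⟩ := hx
  obtain ⟨v, rfl⟩ := hy
  have h := inner_square_mul_self_nonneg u v
  rwa [inner_mul_right_comm] at h

/-- For `x` in the cone of squares, `⟨x y, y⟩ = 0` forces `x y = 0`. -/
theorem mul_eq_zero_of_inner_mul_self_eq_zero {x y : V} (hx : x ∈ coneOfSquares V)
    (h : inner ℝ (x * y) y = 0) : x * y = 0 := by
  obtain ⟨u, rfl⟩ := hx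
  have hnonneg : ∀ v : V, 0 ≤ inner ℝ ((u * u) * v) v := inner_square_mul_self_nonneg u
  set T := mulOp (u * u)
  -- Positivity at `y + t T y` gives a nonnegative quadratic in `t` with no constant term, so its
  -- linear coefficient `2‖T y‖²` vanishes.
  have key : ∀ t : ℝ, 0 ≤ inner ℝ (T (T y)) (T y) * (t * t)
      + 2 * inner ℝ (T y) (T y) * t + 0 := fun t => by
    have h' := hnonneg (y + t • T y)
    change 0 ≤ inner ℝ (T (y + t • T y)) (y + t • T y) at h'
    have hs : inner ℝ (T (T y)) y = inner ℝ (T y) (T y) := mulOp_isSymmetric _ _ _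
    change inner ℝ (T y) y = 0 at h
    rw [map_add, map_smul, inner_add_left, inner_add_right, inner_add_right,
      real_inner_smul_left, real_inner_smul_left, real_inner_smul_right, real_inner_smul_right,
      hs, h] at h'
    linarith
  have hd := discrim_le_zero key
  rw [discrim] at hd
  have : inner ℝ (T y) (T y) = 0 := by nlinarith [sq_nonneg (inner ℝ (T y) (T y) : ℝ)]
  exact inner_self_eq_zero.1 this

/-! ### Positive parts and projection onto the cone. -/

/-- The positive part of an element. -/
noncomputable def posPart (z : V) : V := funCalc z fun t => max t 0

/-- The negative part of an element. -/
noncomputable def negPart (z : V) : V := funCalc z fun t => max (-t) 0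

theorem posPart_mem (z : V) : posPart z ∈ coneOfSquares V :=
  funCalc_mem_coneOfSquares fun _ _ => le_max_right _ _

theorem negPart_mem (z : V) : negPart z ∈ coneOfSquares V :=
  funCalc_mem_coneOfSquares fun _ _ => le_max_right _ _

theorem posPart_sub_negPart (z : V) : posPart z - negPart z = z := by
  conv_rhs => rw [← funCalc_id z]
  rw [posPart, negPart, ← funCalc_sub]
  refine funCalc_congr fun μ _ => ?_
  rcases le_total μ 0 with h | h
  · rw [max_eq_right h, max_eq_left (neg_nonneg.2 h), zero_sub, neg_neg]
  · rw [max_eq_left h, max_eq_right (neg_nonpos.2 h), sub_zero]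

theorem posPart_mul_negPart (z : V) : posPart z * negPart z = 0 := by
  rw [posPart, negPart, ← funCalc_mul, ← funCalc_zero z]
  refine funCalc_congr fun μ _ => ?_
  rcases le_total μ 0 with h | h
  · rw [max_eq_right h, zero_mul]
  · rw [max_eq_right (neg_nonpos.2 h), mul_zero]

theorem inner_posPart_negPart (z : V) : inner ℝ (posPart z) (negPart z) = 0 := by
  rw [← inner_mul_one, posPart_mul_negPart, inner_zero_left]

theorem mul_posPart (z : V) : z * posPart z = posPart z * posPart z := by
  have h := (mulOp (posPart z)).map_sub (posPart z) (negPart z)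
  rw [posPart_sub_negPart, mulOp_apply, mulOp_apply, mulOp_apply, posPart_mul_negPart,
    sub_zero] at h
  rw [mul_comm, h]

theorem mul_negPart (z : V) : z * negPart z = -(negPart z * negPart z) := by
  have h := (mulOp (negPart z)).map_sub (posPart z) (negPart z)
  rw [posPart_sub_negPart, mulOp_apply, mulOp_apply, mulOp_apply, mul_comm (negPart z) (posPart z),
    posPart_mul_negPart, zero_sub] at h
  rw [mul_comm, h]

/-- The metric projection onto the cone of squares is the positive part. -/
theorem isMetricProjection_posPart (z : V) :
    IsMetricProjection (coneOfSquares V) z (posPart z) := by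
  -- The extra term `‖z⁺ - y‖²` gives uniqueness as well as minimality.
  have key : ∀ y ∈ coneOfSquares V,
      ‖z - posPart z‖ ^ 2 + ‖posPart z - y‖ ^ 2 ≤ ‖z - y‖ ^ 2 := fun y hy => by
    have hz : z - posPart z = -negPart z := by
      rw [sub_eq_iff_eq_add, neg_add_eq_sub, posPart_sub_negPart]
    have hzy : z - y = -negPart z + (posPart z - y) := by rw [← hz]; abel
    rw [hz, hzy, norm_add_sq_real, inner_neg_left, inner_sub_right,
      real_inner_comm (posPart z) (negPart z), inner_posPart_negPart]
    have := inner_nonneg_of_mem_coneOfSquares (negPart_mem z) hy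
    linarith
  refine ⟨posPart_mem z, fun y hy => ?_, fun q hq hmin => ?_⟩
  · refine le_of_sq_le_sq ?_ (norm_nonneg _)
    linarith [key y hy, sq_nonneg ‖posPart z - y‖]
  · have h₁ := key q hq
    have h₂ := pow_le_pow_left₀ (norm_nonneg _) (hmin _ (posPart_mem z)) 2
    have h₃ : ‖posPart z - q‖ ^ 2 = 0 := le_antisymm (by linarith) (sq_nonneg _)
    rw [sq_eq_zero_iff, norm_eq_zero, sub_eq_zero] at h₃
    exact h₃.symm

/-! ### Support idempotents and faces. -/

/-- If `x ≤ t e` and `x` is annihilated by the idempotent `e - c`, then `x ≤ t c`. -/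
theorem coneLE_smul_idempotent {c x : V} {t : ℝ} (hc : (1 - c) * (1 - c) = 1 - c)
    (hxc : (1 - c) * x = 0) (hcc : (1 - c) * c = 0)
    (hx : ConeLE (coneOfSquares V) x (t • 1)) : ConeLE (coneOfSquares V) x (t • c) := by
  set c' := 1 - c with hc'
  set s := t • c - x with hs
  have hc's : c' * s = 0 := by
    rw [hs, ← mulOp_apply, map_sub, map_smul, mulOp_apply, mulOp_apply, hxc, hcc, smul_zero,
      sub_zero]
  -- The value is `⟨c', (s⁻)²⟩ = -⟨c', s s⁻⟩ = -⟨c' s, s⁻⟩`.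
  have h₁ : inner ℝ (c' * negPart s) (negPart s) = 0 := by
    rw [inner_mul_right_comm, ← neg_neg (negPart s * negPart s), ← mul_negPart, inner_neg_right,
      ← inner_mul_right_comm, hc's, inner_zero_left, neg_zero]
  have h₂ : c' * negPart s = 0 := mul_eq_zero_of_inner_mul_self_eq_zero ⟨c', hc⟩ h₁
  have h₃ : inner ℝ c' (negPart s) = 0 := by rw [← inner_mul_one, h₂, inner_zero_left]
  have h₄ : inner ℝ s (negPart s) = inner ℝ (t • 1 - x) (negPart s) := by
    have : s = (t • 1 - x) - t • c' := by rw [hs, hc', smul_sub]; abel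
    have h := congrArg (fun v => inner ℝ v (negPart s)) this
    rw [h, inner_sub_left _ (t • c'), real_inner_smul_left, h₃, mul_zero, sub_zero]
  have h₅ : inner ℝ s (negPart s) = -inner ℝ (negPart s) (negPart s) := by
    have h := inner_sub_left (𝕜 := ℝ) (posPart s) (negPart s) (negPart s)
    rwa [posPart_sub_negPart, inner_posPart_negPart, zero_sub] at h
  have h₆ := inner_nonneg_of_mem_coneOfSquares hx (negPart_mem s)
  -- `-‖s⁻‖² = ⟨s, s⁻⟩ = ⟨t e - x, s⁻⟩ ≥ 0`.
  have h₇ : negPart s = 0 := by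
    refine inner_self_eq_zero (𝕜 := ℝ).1 (le_antisymm ?_ real_inner_self_nonneg)
    linarith
  have h₈ := posPart_sub_negPart s
  rw [h₇, sub_zero] at h₈
  change s ∈ _
  rw [← h₈]
  exact posPart_mem s

/-- Every element is dominated by a nonnegative multiple of the unit. -/
theorem exists_coneLE_smul_one (x : V) :
    ∃ t : ℝ, 0 ≤ t ∧ ConeLE (coneOfSquares V) x (t • 1) := by
  refine ⟨∑ μ ∈ mulSpectrum x, |μ|, Finset.sum_nonneg fun _ _ => abs_nonneg _, ?_⟩
  have h : (∑ μ ∈ mulSpectrum x, |μ|) • (1 : V) - x =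
      funCalc x (fun s => (∑ μ ∈ mulSpectrum x, |μ|) * 1 - s) := by
    rw [funCalc_sub, funCalc_smul, funCalc_one, funCalc_id]
  rw [ConeLE, h]
  refine funCalc_mem_coneOfSquares fun μ hμ => ?_
  have := Finset.single_le_sum (f := fun μ : ℝ => |μ|) (fun _ _ => abs_nonneg _) hμ
  have := le_abs_self μ
  linarith

/-- Every element `w` of the cone of squares has a support idempotent `c`: it is dominated by
a multiple of `w`, and `e - c` annihilates `w`. -/
theorem exists_support_idempotent {w : V} (hw : w ∈ coneOfSquares V) :
    ∃ c : V, c ∈ coneOfSquares V ∧ (1 - c) * (1 - c) = 1 - c ∧ (1 - c) * c = 0 ∧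
      inner ℝ w (1 - c) = 0 ∧ ∃ t : ℝ, 0 ≤ t ∧ ConeLE (coneOfSquares V) c (t • w) := by
  classical
  obtain ⟨x, rfl⟩ := hw
  have hxx : x * x = funCalc x (fun s => s * s) := by rw [funCalc_mul, funCalc_id]
  have h1 : 1 - funCalc x (fun s => if s = 0 then 0 else 1) =
      funCalc x (fun s => if s = 0 then 1 else 0) := by
    conv_lhs => rw [← funCalc_one x]
    rw [← funCalc_sub]
    exact funCalc_congr fun μ _ => by split_ifs <;> simp
  -- For `w = x²`, the sum bounds `1/μ²` at every nonzero eigenvalue; a zero eigenvalue contributes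
  -- `0⁻¹ = 0`.
  refine ⟨funCalc x fun s => if s = 0 then 0 else 1, ?_, ?_, ?_, ?_,
    ∑ μ ∈ mulSpectrum x, (μ * μ)⁻¹,
    Finset.sum_nonneg fun μ _ => inv_nonneg.2 (mul_self_nonneg μ), ?_⟩
  · exact funCalc_mem_coneOfSquares fun μ _ => by split_ifs <;> simp
  · rw [h1, ← funCalc_mul]
    exact funCalc_congr fun μ _ => by split_ifs <;> simp
  · rw [h1, ← funCalc_mul, ← funCalc_zero x]
    exact funCalc_congr fun μ _ => by split_ifs <;> simp
  · simp only [h1, hxx]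
    rw [← inner_mul_one, ← funCalc_mul]
    have : funCalc x (fun s => s * s * if s = 0 then 1 else 0) = 0 := by
      rw [← funCalc_zero x]
      exact funCalc_congr fun μ _ => by split_ifs with h <;> simp [h]
    rw [this, inner_zero_left]
  · simp only [hxx]
    rw [ConeLE, ← funCalc_smul, ← funCalc_sub]
    refine funCalc_mem_coneOfSquares fun μ hμ => ?_
    split_ifs with h
    · simp [h]
    · have h₁ := Finset.single_le_sum (f := fun μ : ℝ => (μ * μ)⁻¹)
        (fun μ _ => inv_nonneg.2 (mul_self_nonneg μ)) hμ
      have h₂ := mul_le_mul_of_nonneg_right h₁ (mul_self_nonneg μ)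
      rw [inv_mul_cancel₀ (mul_self_ne_zero.2 h)] at h₂
      linarith

/-- The positive part of an element of the span of a face lies in the face. -/
theorem posPart_mem_face {F : PointedCone ℝ V} (hF : IsConeFace (coneOfSquares V) F) {z : V}
    (hz : z ∈ Submodule.span ℝ (F : Set V)) : posPart z ∈ F := by
  -- The span of a convex cone is `F - F`.
  obtain ⟨a, ha, b, hb, rfl⟩ : ∃ a ∈ F, ∃ b ∈ F, a - b = z := by
    induction hz using Submodule.span_induction with
    | mem x hx => exact ⟨x, hx, 0, F.zero_mem, sub_zero x⟩
    | zero => exact ⟨0, F.zero_mem, 0, F.zero_mem, sub_zero 0⟩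
    | add x y _ _ hx hy =>
      obtain ⟨a, ha, b, hb, rfl⟩ := hx
      obtain ⟨c, hc, d, hd, rfl⟩ := hy
      exact ⟨a + c, F.add_mem ha hc, b + d, F.add_mem hb hd, add_sub_add_comm a c b d⟩
    | smul t x _ hx =>
      obtain ⟨a, ha, b, hb, rfl⟩ := hx
      rcases le_total 0 t with ht | ht
      · exact ⟨t • a, F.smul_mem ht ha, t • b, F.smul_mem ht hb, (smul_sub t a b).symm⟩
      · refine ⟨(-t) • b, F.smul_mem (neg_nonneg.2 ht) hb, (-t) • a,
          F.smul_mem (neg_nonneg.2 ht) ha, ?_⟩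
        module
  obtain ⟨c, hcQ, hc, hcc, hwc, t, ht, hcw⟩ :=
    exists_support_idempotent (hF.subset (F.add_mem ha hb))
  have hcF : c ∈ F := hF.mem_of_le c (t • (a + b)) (by rwa [ConeLE, sub_zero]) hcw
    (F.smul_mem ht (F.add_mem ha hb))
  have hc'Q : 1 - c ∈ coneOfSquares V := ⟨1 - c, hc⟩
  have hann : ∀ u ∈ coneOfSquares V, inner ℝ u (1 - c) = 0 → u * (1 - c) = 0 := fun u hu h =>
    mul_eq_zero_of_inner_mul_self_eq_zero hu (by rwa [inner_mul_right_comm, hc])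
  have ha' := inner_nonneg_of_mem_coneOfSquares (hF.subset ha) hc'Q
  have hb' := inner_nonneg_of_mem_coneOfSquares (hF.subset hb) hc'Q
  rw [inner_add_left] at hwc
  -- `⟨a, e - c⟩` and `⟨b, e - c⟩` are nonnegative with sum zero.
  have ha₀ := hann a (hF.subset ha) (by linarith)
  have hb₀ := hann b (hF.subset hb) (by linarith)
  have hz₀ : (1 - c) * (a - b) = 0 := by
    rw [← mulOp_apply, map_sub, mulOp_apply, mulOp_apply, mul_comm, ha₀, mul_comm, hb₀, sub_zero]
  have hp₀ : (1 - c) * posPart (a - b) = 0 := by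
    refine mul_eq_zero_of_inner_mul_self_eq_zero hc'Q ?_
    -- `⟨(e - c) z⁺, z⁺⟩ = ⟨e - c, z z⁺⟩ = ⟨(e - c) z, z⁺⟩ = 0`.
    rw [inner_mul_right_comm, ← mul_posPart, ← inner_mul_right_comm, hz₀, inner_zero_left]
  obtain ⟨r, hr, hpr⟩ := exists_coneLE_smul_one (posPart (a - b))
  exact hF.mem_of_le _ (r • c) (by rw [ConeLE, sub_zero]; exact posPart_mem _)
    (coneLE_smul_idempotent hc hp₀ hcc hpr) (F.smul_mem hr hcF)

end FiniteDimensional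

end EuclideanJordanAlgebra

/-! ### Transport to translated and reflected cones. -/

/-- Metric projections are transported by isometric bijections. -/
theorem IsMetricProjection.image {V : Type*} [NormedAddCommGroup V] {D : Set V} {x p : V}
    (h : IsMetricProjection D x p) (f : V ≃ᵢ V) : IsMetricProjection (f '' D) (f x) (f p) := by
  obtain ⟨hp, hmin, huniq⟩ := h
  simp only [← dist_eq_norm] at hmin huniq
  refine ⟨Set.mem_image_of_mem f hp, ?_, ?_⟩
  · rintro _ ⟨y, hy, rfl⟩
    simpa only [← dist_eq_norm, f.dist_eq] using hmin y hy
  · rintro _ ⟨q, hq, rfl⟩ hq'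
    refine congrArg f (huniq q hq fun y hy => ?_)
    simpa only [← dist_eq_norm, f.dist_eq] using hq' (f y) (Set.mem_image_of_mem f hy)

theorem mainTheorem8 {V : Type*} [NormedAddCommGroup V] [InnerProductSpace ℝ V]
    [FiniteDimensional ℝ V] [EuclideanJordanAlgebra V]
    (F : PointedCone ℝ V) (hF : IsConeFace (coneOfSquares V) F) :
    IsLatticeLike (coneOfSquares V) (Submodule.span ℝ (F : Set V) : Set V) := by
  refine ⟨fun x hx y hy => ?_, fun x hx y hy => ?_⟩
  · refine ⟨x - EuclideanJordanAlgebra.posPart (x - y), ?_, Submodule.sub_mem _ hx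
      (Submodule.subset_span (EuclideanJordanAlgebra.posPart_mem_face hF
        (Submodule.sub_mem _ hx hy)))⟩
    -- The isometry `v ↦ x - v` takes `Q` to `x - Q` and `x - y` to `y`.
    have h := (EuclideanJordanAlgebra.isMetricProjection_posPart (x - y)).image
      (IsometryEquiv.subLeft x)
    simpa [Set.singleton_sub] using h
  · refine ⟨x + EuclideanJordanAlgebra.posPart (y - x), ?_, Submodule.add_mem _ hx
      (Submodule.subset_span (EuclideanJordanAlgebra.posPart_mem_face hF
        (Submodule.sub_mem _ hy hx)))⟩
    have h := (EuclideanJordanAlgebra.isMetricProjection_posPart (y - x)).image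
      (IsometryEquiv.addLeft x)
    simpa [Set.singleton_add] using h
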